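/- Let $n\ge 0$, $m\ge 3n+1$, $k\in\{1,2,\dots\}\cup\{\infty\}$, and let $K\subset\mathbb R^n$ be compact. Let $\mathrm{emb}^k(\mathbb R^n,\mathbb R^m)$ be the set of $C^k$ maps $f:\mathbb R^n\to\mathbb R^m$ that are homeomorphisms onto their image and whose differential is injective at every point. Let $\mathrm{emb}^k(K,\mathbb R^m)$ be the set of maps $f:K\to\mathbb R^m$ that are homeomorphisms onto their image and extend to a $C^k$ map on an open neighbourhood of $K$ whose differential is injective at every point of $K$. Let $\mathcal I^k(\mathbb R^n,\mathbb R^m)$ be the set of extendable embeddings, that is, of maps $\Phi\circ L$ with $\Phi$ a $C^k$ diffeomorphism of $\mathbb R^m$ onto itself and $L\in\mathbb R^{m\times n}$ of rank $n$, and let $\mathcal I^k(K,\mathbb R^m)$ be the set of restrictions to $K$ of its elements. Then: (a) for every $f\in\mathrm{emb}^k(\mathbb R^n,\mathbb R^m)$ there is $E\in\mathcal I^k(\mathbb R^n,\mathbb R^m)$ with $E(K)=f(K)$; (b) for every $f\in\mathrm{emb}^k(\mathbb R^n,\mathbb R^m)$ there is a $C^k$ diffeomorphism $\Phi$ of $\mathbb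 R^m$ with $f(x)=\Phi(R(x))$ for all $x\in K$, where $R:\mathbb R^n\to\mathbb R^m$, $R(x)=(x,0)$, is zero padding; (c) $\mathcal I^k(K,\mathbb R^m)=\mathrm{emb}^k(K,\mathbb R^m)$. -/

import Mathlib

open scoped Manifold ContDiff

/-- `ℝᵈ` with its Euclidean structure. -/
abbrev Euc (d : ℕ) : Type := EuclideanSpace ℝ (Fin d)

/-- `embᵏ(ℝⁿ, ℝᵐ)`: the topological embeddings (continuous, injective, with continuous inverse on
the image) that are of class `Cᵏ` and have an injective differential at every point. -/
def EmbC (k : ℕ∞) (n m : ℕ) : Set (Euc n → Euc m) :=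
  {f | Topology.IsEmbedding f ∧ ContDiff ℝ k f ∧ ∀ x, Function.Injective (fderiv ℝ f x)}

/-- `embᵏ(K, ℝᵐ)` for a subset `K` of `ℝⁿ`: the topological embeddings `K → ℝᵐ` that extend to a
`Cᵏ` map on an open neighbourhood of `K` whose differential is injective at every point of `K`.
The extension itself need not be injective off `K`. -/
def EmbCOn (k : ℕ∞) {n : ℕ} (m : ℕ) (K : Set (Euc n)) : Set (K → Euc m) :=
  {f | Topology.IsEmbedding f ∧
    ∃ (U : Set (Euc n)) (g : Euc n → Euc m), IsOpen U ∧ K ⊆ U ∧ ContDiffOn ℝ k g U ∧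
      (∀ x : K, g x = f x) ∧ ∀ x ∈ K, Function.Injective (fderiv ℝ g x)}

/-- `Diffᵏ(ℝᵐ, ℝᵐ)`: the `Cᵏ` diffeomorphisms of `ℝᵐ` onto itself, as functions. -/
def DiffC (k : ℕ∞) (m : ℕ) : Set (Euc m → Euc m) :=
  Set.range fun Φ : Diffeomorph 𝓘(ℝ, Euc m) 𝓘(ℝ, Euc m) (Euc m) (Euc m) k => (Φ : Euc m → Euc m)

/-- The linear maps `ℝⁿ → ℝᵐ` given by an `m × n` matrix of rank `n`, as functions. -/
def FullRank (n m : ℕ) : Set (Euc n → Euc m) :=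
  {l | ∃ L : Matrix (Fin m) (Fin n) ℝ, L.rank = n ∧ l = fun x => Matrix.toEuclideanLin L x}

/-- `ℐᵏ(ℝⁿ, ℝᵐ)`: the extendable embeddings `Φ ∘ L`, with `Φ` a `Cᵏ` diffeomorphism of `ℝᵐ` and
`L` linear of rank `n`. -/
def ExtEmb (k : ℕ∞) (n m : ℕ) : Set (Euc n → Euc m) :=
  {E | ∃ Φ ∈ DiffC k m, ∃ L ∈ FullRank n m, E = Φ ∘ L}

/-- `ℐᵏ(K, ℝᵐ)`: the restrictions to `K` of the extendable embeddings. -/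
def ExtEmbOn (k : ℕ∞) {n : ℕ} (m : ℕ) (K : Set (Euc n)) : Set (K → Euc m) :=
  K.domRestrict '' ExtEmb k n m

/-- Zero padding `x ↦ (x, 0)` from `ℝⁿ` to `ℝᵐ` (used for `n ≤ m`). -/
def zeroPad (n m : ℕ) (x : Euc n) : Euc m :=
  WithLp.toLp 2 fun i : Fin m => if h : (i : ℕ) < n then x ⟨i, h⟩ else 0

open Set Filter Topology Module

/-! ### Localisation by cutoff functions. -/

section Cutoff

variable {E F : Type*} [NormedAddCommGroup E] [NormedSpace ℝ E] [FiniteDimensional ℝ E]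
  [NormedAddCommGroup F] [NormedSpace ℝ F]

/-! All three parts reduce to straightening an injective immersion `f` of `K` onto zero padding by
an ambient diffeomorphism. Suppose first that `f` is smooth. As `m > 3n`, some `n`-dimensional
subspace `A` avoids all nonzero secants and tangent vectors
(`ContDiff.exists_submodule_secant_tangent`). Split `ℝᵐ` as `ℝⁿ × B` with `A` as first factor and
write `f = (p, q)`. Then `q` is still an injective immersion of `K`, so it has a global left inverse
`r` on `K`. Two shears finish: adding `r b - p (r b)` to the first coordinate takes `(p x, q x)` to
`(x, q x)`, and subtracting `q a` from the second gives `(x, 0)`. Avoiding tangents takes two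
derivatives, so a `Cᵏ` map is smoothed beforehand: with `g` a mollification of `f` and `r` now a
left inverse of `f`, the map `y ↦ y + (g - f) (r y)` is a small perturbation of the identity and
sends `f x` to `g x` on `K`. -/

theorem exists_contDiff_hasCompactSupport_one_nhds {K U : Set E} (hK : IsCompact K)
    (hU : IsOpen U) (hKU : K ⊆ U) :
    ∃ χ : E → ℝ, ContDiff ℝ ∞ χ ∧ HasCompactSupport χ ∧ tsupport χ ⊆ U ∧
      ∀ᶠ x in 𝓝ˢ K, χ x = 1 := by
  have : ProperSpace E := FiniteDimensional.proper ℝ E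
  obtain ⟨L, hL, hKL, hLU⟩ := exists_compact_between hK hU hKU
  obtain ⟨χ, h1, h0, -⟩ := exists_contMDiffMap_one_nhds_of_subset_interior (n := ⊤) 𝓘(ℝ, E)
    hK.isClosed hKL
  have hsupp : tsupport χ ⊆ L :=
    closure_minimal (fun x hx => by_contra fun hxL => hx (h0 x hxL)) hL.isClosed
  exact ⟨χ, χ.contMDiff.contDiff, hL.of_isClosed_subset (isClosed_tsupport _) hsupp,
    hsupp.trans hLU, h1⟩

/-- A `Cᵏ` map on a neighbourhood of a compact set agrees near this set with a `Cᵏ` map of compact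
support. -/
theorem exists_contDiff_hasCompactSupport_eventuallyEq {k : ℕ∞} {K U : Set E} (hK : IsCompact K)
    (hU : IsOpen U) (hKU : K ⊆ U) {g : E → F} (hg : ContDiffOn ℝ k g U) :
    ∃ f : E → F, ContDiff ℝ k f ∧ HasCompactSupport f ∧ ∀ x ∈ K, f =ᶠ[𝓝 x] g := by
  obtain ⟨χ, hχ, hχc, hχU, hχ1⟩ := exists_contDiff_hasCompactSupport_one_nhds hK hU hKU
  refine ⟨fun x => χ x • g x, contDiff_iff_contDiffAt.2 fun x => ?_, hχc.smul_right, fun x hx => ?_⟩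
  · by_cases hx : x ∈ tsupport χ
    · exact ((hχ.of_le (mod_cast le_top)).contDiffAt).smul (hg.contDiffAt (hU.mem_nhds (hχU hx)))
    · refine (contDiffAt_const (c := (0 : F))).congr_of_eventuallyEq ?_
      filter_upwards [notMem_tsupport_iff_eventuallyEq.1 hx] with y hy
      simp [hy]
  · filter_upwards [(eventually_nhdsSet_iff_forall.1 hχ1) x hx] with y hy
    simp [hy]

end Cutoff

/-! ### Left inverses of immersions. -/

section LeftInverse

variable {E V : Type*} [NormedAddCommGroup E] [NormedSpace ℝ E] [FiniteDimensional ℝ E]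
  [NormedAddCommGroup V] [NormedSpace ℝ V] [FiniteDimensional ℝ V]

/-- Composing `f` with a linear left inverse `L` of its differential gives a map to which the
inverse function theorem applies. -/
theorem ContDiff.exists_local_leftInverse {k : ℕ∞} (hk : 1 ≤ k) {f : E → V}
    (hf : ContDiff ℝ k f) {x₀ : E} (hinj : Function.Injective (fderiv ℝ f x₀)) :
    ∃ N : Set E, IsOpen N ∧ x₀ ∈ N ∧ ∃ W : Set V, IsOpen W ∧ f x₀ ∈ W ∧
      ∃ r : V → E, ContDiffOn ℝ k r W ∧ ∀ x ∈ N, r (f x) = x := by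
  have hk0 : (k : WithTop ℕ∞) ≠ 0 := by
    have : k ≠ 0 := (zero_lt_one.trans_le hk).ne'
    exact_mod_cast this
  have : CompleteSpace E := FiniteDimensional.complete ℝ E
  obtain ⟨l, hl⟩ := LinearMap.exists_leftInverse_of_injective (fderiv ℝ f x₀ : E →ₗ[ℝ] V)
    (LinearMap.ker_eq_bot.2 hinj)
  set L : V →L[ℝ] E := LinearMap.toContinuousLinearMap l
  set h : E → E := fun x => L (f x)
  have hh : ContDiff ℝ k h := L.contDiff.comp hf
  have hd : HasFDerivAt h ((ContinuousLinearEquiv.refl ℝ E : E ≃L[ℝ] E) : E →L[ℝ] E) x₀ := by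
    have := L.hasFDerivAt.comp x₀ ((hf.differentiable hk0) x₀).hasFDerivAt
    refine this.congr_fderiv ?_
    ext v
    exact LinearMap.congr_fun hl v
  set φ := hh.contDiffAt.toOpenPartialHomeomorph h hd hk0
  have hφ : ∀ x, φ x = h x := fun _ => rfl
  have hx₀ : x₀ ∈ φ.source := hh.contDiffAt.mem_toOpenPartialHomeomorph_source hd hk0
  -- The local inverse is shown to be `Cᵏ` only where the derivative of `h` is invertible.
  set O : Set E := fderiv ℝ h ⁻¹' range ((↑) : (E ≃L[ℝ] E) → E →L[ℝ] E)
  have hO : IsOpen O := ContinuousLinearEquiv.isOpen.preimage (hh.continuous_fderiv hk0)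
  have hx₀O : x₀ ∈ O := ⟨_, hd.fderiv.symm⟩
  have hW : IsOpen (φ.target ∩ φ.symm ⁻¹' O) := φ.symm.isOpen_inter_preimage hO
  refine ⟨φ.source, φ.open_source, hx₀, L ⁻¹' (φ.target ∩ φ.symm ⁻¹' O), hW.preimage L.continuous,
    ⟨φ.map_source hx₀, ?_⟩, fun y => φ.symm (L y), fun y hy => ?_, fun x hx => φ.left_inv hx⟩
  · have := φ.left_inv hx₀
    rw [hφ] at this
    show φ.symm (h x₀) ∈ O
    rwa [this]
  · obtain ⟨e, he⟩ := hy.2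
    have h1 : ContDiffAt ℝ k φ.symm (L y) :=
      φ.contDiffAt_symm hy.1 (f₀' := e)
        (by rw [he]; exact ((hh.differentiable hk0) _).hasFDerivAt) hh.contDiffAt
    exact (h1.comp y L.contDiff.contDiffAt).contDiffWithinAt

/-- An injective immersion of a compact set has a globally defined left inverse of the same
class. -/
theorem ContDiff.exists_leftInverse_on_isCompact {k : ℕ∞} (hk : 1 ≤ k) {f : E → V}
    (hf : ContDiff ℝ k f) {K : Set E} (hK : IsCompact K) (hinj : InjOn f K)
    (himm : ∀ x ∈ K, Function.Injective (fderiv ℝ f x)) :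
    ∃ r : V → E, ContDiff ℝ k r ∧ ∀ x ∈ K, r (f x) = x := by
  suffices ∃ r : C^k⟮𝓘(ℝ, V), V; 𝓘(ℝ, E), E⟯, ∀ y, r y ∈ {v : E | ∀ x ∈ K, f x = y → v = x} by
    obtain ⟨r, hr⟩ := this
    exact ⟨r, r.contMDiff.contDiff, fun x hx => hr (f x) x hx rfl⟩
  -- The condition on `r y` is convex, so local solutions glue by a partition of unity.
  refine exists_contMDiffMap_forall_mem_convex_of_local 𝓘(ℝ, V) ?_ ?_
  · intro y a ha b hb s t _ _ hst x hx hxy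
    rw [ha x hx hxy, hb x hx hxy, ← add_smul, hst, one_smul]
  · intro y
    by_cases hy : y ∈ f '' K
    · obtain ⟨x₀, hx₀, rfl⟩ := hy
      obtain ⟨N, hN, hxN, W, hW, hxW, r, hr, hrf⟩ := hf.exists_local_leftInverse hk (himm x₀ hx₀)
      -- Removing this compact set leaves only values whose preimages in `K` lie in `N`.
      have hc : IsClosed (f '' (K \ N)) := ((hK.diff hN).image hf.continuous).isClosed
      have hnot : f x₀ ∉ f '' (K \ N) := by
        rintro ⟨x, hx, hxe⟩
        exact hx.2 (hinj hx.1 hx₀ hxe ▸ hxN)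
      refine ⟨W ∩ (f '' (K \ N))ᶜ, inter_mem (hW.mem_nhds hxW) (hc.isOpen_compl.mem_nhds hnot), r,
        (hr.mono inter_subset_left).contMDiffOn, ?_⟩
      rintro _ hz x hx rfl
      exact hrf x (by_contra fun hxN' => hz.2 ⟨x, ⟨hx, hxN'⟩, rfl⟩)
    · refine ⟨(f '' K)ᶜ, (hK.image hf.continuous).isClosed.isOpen_compl.mem_nhds hy, fun _ => 0,
        contMDiffOn_const, ?_⟩
      rintro _ hz x hx rfl
      exact absurd ⟨x, hx, rfl⟩ hz

end LeftInverse

/-! ### Mollification. -/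

section Mollify

open MeasureTheory ContinuousLinearMap in
/-- A compactly supported `C¹` map is uniformly `C¹`-close to smooth maps. -/
theorem ContDiff.exists_contDiff_top_fderiv_sub_le {E V : Type*} [NormedAddCommGroup E]
    [NormedSpace ℝ E] [FiniteDimensional ℝ E] [NormedAddCommGroup V] [NormedSpace ℝ V]
    [CompleteSpace V] {f : E → V} (hf : ContDiff ℝ 1 f) (hc : HasCompactSupport f)
    {ε : ℝ} (hε : 0 < ε) :
    ∃ g : E → V, ContDiff ℝ ∞ g ∧ ∀ x, ‖fderiv ℝ g x - fderiv ℝ f x‖ ≤ ε := by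
  borelize E
  let μ : Measure E := Measure.addHaar
  have hdc : Continuous (fderiv ℝ f) := hf.continuous_fderiv one_ne_zero
  obtain ⟨δ, hδ, hfδ⟩ := Metric.uniformContinuous_iff.1
    ((hc.fderiv ℝ).uniformContinuous_of_continuous hdc) ε hε
  let φ : ContDiffBump (0 : E) := ⟨δ / 2, δ, half_pos hδ, half_lt_self hδ⟩
  have hφ : LocallyIntegrable (φ.normed μ) μ := φ.continuous_normed.locallyIntegrable
  refine ⟨convolution (φ.normed μ) f (lsmul ℝ ℝ) μ,
    φ.hasCompactSupport_normed.contDiff_convolution_left _ φ.contDiff_normed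
      hf.continuous.locallyIntegrable, fun x => ?_⟩
  have hd := hc.hasFDerivAt_convolution_right (lsmul ℝ ℝ) hφ hf x
  have heq : convolution (φ.normed μ) (fderiv ℝ f) ((lsmul ℝ ℝ : ℝ →L[ℝ] V →L[ℝ] V).precompR E) μ x
      = convolution (φ.normed μ) (fderiv ℝ f) (lsmul ℝ ℝ) μ x := by
    refine integral_congr_ae (Eventually.of_forall fun t => ?_)
    ext v
    simp [precompR_apply]
  rw [hd.fderiv, heq, ← dist_eq_norm]
  refine ContDiffBump.dist_normed_convolution_le hdc.aestronglyMeasurable fun y hy => ?_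
  exact (hfδ (Metric.mem_ball.1 hy)).le

end Mollify

/-! ### Perturbations of the identity. -/

section Perturbation

variable {V : Type*} [NormedAddCommGroup V] [NormedSpace ℝ V] [CompleteSpace V]

/-- A `Cᵏ` perturbation of the identity with small derivative is a diffeomorphism. -/
theorem exists_diffeomorph_eq_id_add {k : ℕ∞} (hk : 1 ≤ k) {u : V → V} (hu : ContDiff ℝ k u)
    (hsmall : ∀ y, ‖fderiv ℝ u y‖ ≤ 1 / 2) :
    ∃ Φ : Diffeomorph 𝓘(ℝ, V) 𝓘(ℝ, V) V V k, ∀ y, Φ y = y + u y := by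
  have hk0 : (k : WithTop ℕ∞) ≠ 0 := by
    have : k ≠ 0 := (zero_lt_one.trans_le hk).ne'
    exact_mod_cast this
  have hud : Differentiable ℝ u := hu.differentiable hk0
  have hlip : LipschitzWith (1 / 2) u :=
    lipschitzWith_of_nnnorm_fderiv_le hud fun y => by exact_mod_cast hsmall y
  have happ : ApproximatesLinearOn (fun y => y + u y)
      ((ContinuousLinearEquiv.refl ℝ V : V ≃L[ℝ] V) : V →L[ℝ] V) univ (1 / 2) := by
    intro x _ y _
    have := hlip.dist_le_mul x y
    rw [dist_eq_norm, dist_eq_norm] at this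
    rwa [show x + u x - (y + u y) - (ContinuousLinearEquiv.refl ℝ V : V →L[ℝ] V) (x - y) =
      u x - u y from by rw [ContinuousLinearEquiv.coe_refl, ContinuousLinearMap.id_apply]; abel]
  have hc : Subsingleton V ∨ (1 / 2 : NNReal) <
      ‖((ContinuousLinearEquiv.refl ℝ V).symm : V →L[ℝ] V)‖₊⁻¹ := by
    rcases subsingleton_or_nontrivial V with h | h
    · exact Or.inl h
    · right
      have : ‖((ContinuousLinearEquiv.refl ℝ V).symm : V →L[ℝ] V)‖₊ = 1 :=
        NNReal.eq (ContinuousLinearMap.norm_id (𝕜 := ℝ) (E := V))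
      rw [this, inv_one]
      exact NNReal.half_lt_self one_ne_zero
  let Ψ : V ≃ₜ V := happ.toHomeomorph _ hc
  have hΨ : ⇑Ψ = fun y => y + u y := rfl
  have hΨc : ContDiff ℝ k Ψ := hΨ ▸ contDiff_id.add hu
  have hlt : ∀ y, ‖-fderiv ℝ u y‖ < 1 := fun y => by
    rw [norm_neg]; exact (hsmall y).trans_lt one_half_lt_one
  -- The derivative `1 + Du` is invertible by the Neumann series.
  let e : V → V ≃L[ℝ] V := fun y =>
    ContinuousLinearEquiv.unitsEquiv ℝ V (Units.oneSub (-fderiv ℝ u y) (hlt y))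
  have he : ∀ y, HasFDerivAt Ψ (e y : V →L[ℝ] V) y := fun y => by
    have := (hasFDerivAt_id y).add (hud y).hasFDerivAt
    refine this.congr_fderiv ?_
    ext v
    simp [e]
  exact ⟨⟨Ψ.toEquiv, hΨc.contMDiff, (Ψ.contDiff_symm he hΨc).contMDiff⟩, fun _ => rfl⟩

end Perturbation

/-! ### Generic projections by dimension count. -/

section Whitney

variable {E V : Type*} [NormedAddCommGroup E] [NormedSpace ℝ E] [FiniteDimensional ℝ E]
  [NormedAddCommGroup V] [NormedSpace ℝ V] [FiniteDimensional ℝ V]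

/-- A `C¹` map does not raise Hausdorff dimension, so neither range, nor their union, can fill `V`.
-/
theorem exists_notMem_range_of_contDiff {X Y : Type*} [NormedAddCommGroup X] [NormedSpace ℝ X]
    [FiniteDimensional ℝ X] [NormedAddCommGroup Y] [NormedSpace ℝ Y] [FiniteDimensional ℝ Y]
    {p : X → V} {q : Y → V} (hp : ContDiff ℝ 1 p) (hq : ContDiff ℝ 1 q)
    (hX : finrank ℝ X < finrank ℝ V) (hY : finrank ℝ Y < finrank ℝ V) :
    ∃ v, v ∉ range p ∧ v ∉ range q := by
  have h : dimH (range p ∪ range q) < finrank ℝ V := by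
    rw [dimH_union]
    exact max_lt (hp.dimH_range_le.trans_lt (Nat.cast_lt.2 hX))
      (hq.dimH_range_le.trans_lt (Nat.cast_lt.2 hY))
  obtain ⟨v, hv⟩ := (dense_compl_of_dimH_lt_finrank h).nonempty
  exact ⟨v, fun hp => hv (Or.inl hp), fun hq => hv (Or.inr hq)⟩

/-- There are subspaces of dimension `j` that meet the secants and the tangent spaces of a smooth
map only where these vanish, as long as `j + 2 * dim E < dim V`. -/
theorem ContDiff.exists_submodule_secant_tangent {f : E → V} (hf : ContDiff ℝ 2 f) (j : ℕ)
    (hj : j + 2 * finrank ℝ E < finrank ℝ V ∨ j = 0) :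
    ∃ A : Submodule ℝ V, finrank ℝ A = j ∧ (∀ x y, f x - f y ∈ A → f x = f y) ∧
      ∀ x v, fderiv ℝ f x v ∈ A → fderiv ℝ f x v = 0 := by
  induction j with
  | zero => exact ⟨⊥, finrank_bot ℝ V, fun x y h => sub_eq_zero.1 ((Submodule.mem_bot ℝ).1 h),
      fun x v h => (Submodule.mem_bot ℝ).1 h⟩
  | succ j ih =>
    have hj : j + 1 + 2 * finrank ℝ E < finrank ℝ V := by omega
    obtain ⟨A, hA, hsec, htan⟩ := ih (Or.inl (by omega))
    have hdf : ContDiff ℝ 1 (fderiv ℝ f) := hf.fderiv_right (by norm_num [one_add_one_eq_two])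
    have hf1 : ContDiff ℝ 1 f := hf.of_le (by norm_num)
    -- The new direction avoids `A` plus the scaled secants, a family of `j + 1 + 2 * dim E`
    -- parameters, and `A` plus the tangents. The scalar makes the avoidance invariant under
    -- rescaling.
    obtain ⟨a, hap, haq⟩ := exists_notMem_range_of_contDiff
      (p := fun z : A × ℝ × E × E => (z.1 : V) + z.2.1 • (f z.2.2.1 - f z.2.2.2))
      (q := fun z : A × E × E => (z.1 : V) + fderiv ℝ f z.2.1 z.2.2)
      (by
        have : ContDiff ℝ 1 fun z : A × ℝ × E × E => (z.1 : V) :=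
          A.subtypeL.contDiff.comp contDiff_fst
        fun_prop)
      (by
        have : ContDiff ℝ 1 fun z : A × E × E => (z.1 : V) :=
          A.subtypeL.contDiff.comp contDiff_fst
        refine this.add (ContDiff.clm_apply (hdf.comp ?_) ?_) <;> fun_prop)
      (by simp only [finrank_prod, finrank_self, hA]; omega)
      (by simp only [finrank_prod, hA]; omega)
    have haA : a ∉ A := fun h => hap ⟨(⟨a, h⟩, 0, 0, 0), by simp⟩
    refine ⟨A ⊔ Submodule.span ℝ {a}, ?_, fun x y h => ?_, fun x v h => ?_⟩
    · have h0 : a ≠ 0 := fun h => haA (h ▸ A.zero_mem)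
      have hdisj : A ⊓ Submodule.span ℝ {a} = ⊥ :=
        (((Submodule.disjoint_span_singleton' h0).2 haA)).eq_bot
      have := Submodule.finrank_sup_add_finrank_inf_eq A (Submodule.span ℝ {a})
      rw [hdisj, finrank_bot, finrank_span_singleton h0, hA] at this
      simpa using this
    · obtain ⟨b, hb, c, hc, hbc⟩ := Submodule.mem_sup.1 h
      obtain ⟨t, rfl⟩ := Submodule.mem_span_singleton.1 hc
      by_cases ht : t = 0
      · exact hsec x y (by rw [← hbc, ht]; simpa using hb)
      · refine absurd ⟨(⟨-(t⁻¹ • b), A.neg_mem (A.smul_mem _ hb)⟩, t⁻¹, x, y), ?_⟩ hap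
        simp [← hbc, smul_smul, inv_mul_cancel₀ ht]
    · obtain ⟨b, hb, c, hc, hbc⟩ := Submodule.mem_sup.1 h
      obtain ⟨t, rfl⟩ := Submodule.mem_span_singleton.1 hc
      by_cases ht : t = 0
      · exact htan x v (by rw [← hbc, ht]; simpa using hb)
      · refine absurd ⟨(⟨-(t⁻¹ • b), A.neg_mem (A.smul_mem _ hb)⟩, x, t⁻¹ • v), ?_⟩ haq
        simp [← hbc, smul_smul, inv_mul_cancel₀ ht]

end Whitney

/-! ### Elementary diffeomorphisms. -/

section Shear

variable {E F : Type*} [NormedAddCommGroup E] [NormedSpace ℝ E]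
  [NormedAddCommGroup F] [NormedSpace ℝ F]

/-- The shear `(a, b) ↦ (a + h b, b)`. -/
def shearFst {k : ℕ∞} (h : F → E) (hh : ContDiff ℝ k h) :
    Diffeomorph 𝓘(ℝ, E × F) 𝓘(ℝ, E × F) (E × F) (E × F) k where
  toFun z := (z.1 + h z.2, z.2)
  invFun z := (z.1 - h z.2, z.2)
  left_inv z := by simp
  right_inv z := by simp
  contMDiff_toFun :=
    (by fun_prop : ContDiff ℝ k fun z : E × F => (z.1 + h z.2, z.2)).contMDiff
  contMDiff_invFun :=
    (by fun_prop : ContDiff ℝ k fun z : E × F => (z.1 - h z.2, z.2)).contMDiff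

/-- The shear `(a, b) ↦ (a, b - h a)`. -/
def shearSnd {k : ℕ∞} (h : E → F) (hh : ContDiff ℝ k h) :
    Diffeomorph 𝓘(ℝ, E × F) 𝓘(ℝ, E × F) (E × F) (E × F) k where
  toFun z := (z.1, z.2 - h z.1)
  invFun z := (z.1, z.2 + h z.1)
  left_inv z := by simp
  right_inv z := by simp
  contMDiff_toFun :=
    (by fun_prop : ContDiff ℝ k fun z : E × F => (z.1, z.2 - h z.1)).contMDiff
  contMDiff_invFun :=
    (by fun_prop : ContDiff ℝ k fun z : E × F => (z.1, z.2 + h z.1)).contMDiff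

/-- A continuous linear equivalence as a `Cᵏ` diffeomorphism. -/
def ContinuousLinearEquiv.diffeomorphOfClass (e : E ≃L[ℝ] F) (k : ℕ∞) :
    Diffeomorph 𝓘(ℝ, E) 𝓘(ℝ, F) E F k where
  toEquiv := e.toEquiv
  contMDiff_toFun := e.contDiff.contMDiff
  contMDiff_invFun := e.symm.contDiff.contMDiff

end Shear

/-! ### Smoothing and straightening. -/

section Straighten

variable {E V : Type*} [NormedAddCommGroup E] [NormedSpace ℝ E] [FiniteDimensional ℝ E]
  [NormedAddCommGroup V] [NormedSpace ℝ V] [FiniteDimensional ℝ V]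

theorem Submodule.exists_continuousLinearEquiv_prod (A : Submodule ℝ V)
    (hA : finrank ℝ A = finrank ℝ E) :
    ∃ (B : Submodule ℝ V) (T : V ≃L[ℝ] E × B), ∀ v, (T v).2 = 0 → v ∈ A := by
  obtain ⟨B, hB⟩ := A.exists_isCompl
  let T : (E × B) ≃ₗ[ℝ] V := ((LinearEquiv.ofFinrankEq A E hA).symm.prodCongr
    (LinearEquiv.refl ℝ B)).trans (Submodule.prodEquivOfIsCompl A B hB)
  refine ⟨B, T.symm.toContinuousLinearEquiv, fun v hv => ?_⟩
  have h : T (T.symm v) = v := T.apply_symm_apply v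
  replace hv : (T.symm v).2 = 0 := hv
  rw [← h]
  show ((LinearEquiv.ofFinrankEq A E hA).symm (T.symm v).1 : V) + ((T.symm v).2 : V) ∈ A
  rw [hv, Submodule.coe_zero, add_zero]
  exact Submodule.coe_mem _

theorem LinearMap.exists_continuousLinearEquiv_prod_extend {B : Type*} [NormedAddCommGroup B]
    [NormedSpace ℝ B] [FiniteDimensional ℝ B] (ι : E →ₗ[ℝ] V) (hι : Function.Injective ι)
    (hdim : finrank ℝ E + finrank ℝ B = finrank ℝ V) :
    ∃ S : (E × B) ≃L[ℝ] V, ∀ x, S (x, 0) = ι x := by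
  obtain ⟨C, hC⟩ := (LinearMap.range ι).exists_isCompl
  have hBC : finrank ℝ B = finrank ℝ C := by
    have h1 := Submodule.finrank_add_eq_of_isCompl hC
    have h2 := LinearMap.finrank_range_of_inj hι
    omega
  let S : (E × B) ≃ₗ[ℝ] V := ((LinearEquiv.ofInjective ι hι).prodCongr
    (LinearEquiv.ofFinrankEq B C hBC)).trans (Submodule.prodEquivOfIsCompl _ C hC)
  refine ⟨S.toContinuousLinearEquiv, fun x => ?_⟩
  show S (x, 0) = ι x
  simp [S, Submodule.coe_prodEquivOfIsCompl']

/-- A diffeomorphism moves an injective immersion of a compact set to a smooth one. -/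
theorem ContDiff.exists_diffeomorph_comp_smooth {k : ℕ∞} (hk : 1 ≤ k) {f : E → V}
    (hf : ContDiff ℝ k f) (hfc : HasCompactSupport f) {K : Set E} (hK : IsCompact K)
    (hinj : InjOn f K) (himm : ∀ x ∈ K, Function.Injective (fderiv ℝ f x)) :
    ∃ (Φ : Diffeomorph 𝓘(ℝ, V) 𝓘(ℝ, V) V V k) (g : E → V), ContDiff ℝ ∞ g ∧
      (∀ x ∈ K, Φ (f x) = g x) ∧ ∀ x ∈ K, Function.Injective (fderiv ℝ g x) := by
  have hk1 : (1 : WithTop ℕ∞) ≤ k := by exact_mod_cast hk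
  have hk0 : (k : WithTop ℕ∞) ≠ 0 := (zero_lt_one.trans_le hk1).ne'
  have hf1 : ContDiff ℝ 1 f := hf.of_le hk1
  obtain ⟨r₀, hr₀, hrf₀⟩ := hf.exists_leftInverse_on_isCompact hk hK hinj himm
  -- Compact support bounds the derivative of `r` globally.
  obtain ⟨r, hr, hrc, hrr⟩ := exists_contDiff_hasCompactSupport_eventuallyEq
    (hK.image hf.continuous) isOpen_univ (subset_univ _) hr₀.contDiffOn
  have hrf : ∀ x ∈ K, r (f x) = x := fun x hx =>
    ((hrr _ ⟨x, hx, rfl⟩).self_of_nhds).trans (hrf₀ x hx)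
  obtain ⟨C, hC⟩ := (hrc.fderiv ℝ).exists_bound_of_continuous (hr.continuous_fderiv hk0)
  obtain ⟨δ, hδ, hthick⟩ := (hK.image (hf.continuous_fderiv hk0)).exists_thickening_subset_open
    ContinuousLinearMap.isOpen_injective (by rintro _ ⟨x, hx, rfl⟩; exact himm x hx)
  have hC0 : 0 ≤ C := (norm_nonneg _).trans (hC 0)
  -- The first bound keeps `Dg` injective on `K`; the second bounds the derivative of the
  -- perturbation by `1 / 2`.
  set ε : ℝ := min (δ / 2) (1 / (2 * (C + 1)))
  have hε : 0 < ε := by positivity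
  obtain ⟨g, hg, hgf⟩ := hf1.exists_contDiff_top_fderiv_sub_le hfc hε
  have hgk : ContDiff ℝ k g := hg.of_le (mod_cast le_top)
  have hgd : Differentiable ℝ g := hgk.differentiable hk0
  have hfd : Differentiable ℝ f := hf.differentiable hk0
  have hrd : Differentiable ℝ r := hr.differentiable hk0
  obtain ⟨Φ, hΦ⟩ := exists_diffeomorph_eq_id_add hk (u := fun y => g (r y) - f (r y))
    ((hgk.comp hr).sub (hf.comp hr)) fun y => by
      have h1 : HasFDerivAt (fun y => g (r y) - f (r y))
          ((fderiv ℝ g (r y) - fderiv ℝ f (r y)).comp (fderiv ℝ r y)) y :=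
        (((hgd _).hasFDerivAt.sub (hfd _).hasFDerivAt)).comp y (hrd y).hasFDerivAt
      rw [h1.fderiv]
      calc _ ≤ ‖fderiv ℝ g (r y) - fderiv ℝ f (r y)‖ * ‖fderiv ℝ r y‖ :=
            ContinuousLinearMap.opNorm_comp_le _ _
        _ ≤ 1 / (2 * (C + 1)) * (C + 1) := by
            gcongr
            · exact (hgf _).trans (min_le_right _ _)
            · exact (hC y).trans (by linarith)
        _ = 1 / 2 := by field_simp
  refine ⟨Φ, g, hg, fun x hx => ?_, fun x hx => ?_⟩
  · rw [hΦ, hrf x hx]; abel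
  · refine hthick (Metric.mem_thickening_iff.2 ⟨_, ⟨x, hx, rfl⟩, ?_⟩)
    rw [dist_eq_norm]
    exact ((hgf x).trans (min_le_left _ _)).trans_lt (half_lt_self hδ)

/-- The two-shear argument, with `S` carrying `E × 0` onto the range of `ι`. -/
theorem ContDiff.exists_diffeomorph_straighten_of_smooth (k : ℕ∞) {g : E → V}
    (hg : ContDiff ℝ ∞ g) {K : Set E} (hK : IsCompact K) (hinj : InjOn g K)
    (himm : ∀ x ∈ K, Function.Injective (fderiv ℝ g x))
    (hdim : 3 * finrank ℝ E + 1 ≤ finrank ℝ V) (ι : E →ₗ[ℝ] V) (hι : Function.Injective ι) :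
    ∃ Φ : Diffeomorph 𝓘(ℝ, V) 𝓘(ℝ, V) V V k, ∀ x ∈ K, Φ (g x) = ι x := by
  have hg2 : ContDiff ℝ 2 g := contDiff_infty.1 hg 2
  obtain ⟨A, hA, hsec, htan⟩ := hg2.exists_submodule_secant_tangent (finrank ℝ E) (by omega)
  obtain ⟨B, T, hT⟩ := A.exists_continuousLinearEquiv_prod (E := E) hA
  obtain ⟨S, hS⟩ := ι.exists_continuousLinearEquiv_prod_extend hι (B := B)
    (by rw [T.toLinearEquiv.finrank_eq, finrank_prod])
  set p : E → E := fun x => (T (g x)).1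
  set q : E → B := fun x => (T (g x)).2
  have hp : ContDiff ℝ ∞ p := contDiff_fst.comp (T.contDiff.comp hg)
  have hq : ContDiff ℝ ∞ q := contDiff_snd.comp (T.contDiff.comp hg)
  have hqinj : InjOn q K := fun x hx y hy hxy => hinj hx hy <| hsec x y <| hT _ <| by
    rw [map_sub]; exact sub_eq_zero.2 hxy
  have hqimm : ∀ x ∈ K, Function.Injective (fderiv ℝ q x) := fun x hx => by
    have hd : HasFDerivAt q ((ContinuousLinearMap.snd ℝ E B).comp
        ((T : V →L[ℝ] E × B).comp (fderiv ℝ g x))) x :=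
      (ContinuousLinearMap.snd ℝ E B).hasFDerivAt.comp x
        ((T : V →L[ℝ] E × B).hasFDerivAt.comp x
          ((hg.differentiable (by simp)) x).hasFDerivAt)
    rw [hd.fderiv]
    refine (injective_iff_map_eq_zero _).2 fun v hv => ?_
    exact (injective_iff_map_eq_zero _).1 (himm x hx) v (htan x v (hT _ hv))
  obtain ⟨r, hr, hrq⟩ := hq.exists_leftInverse_on_isCompact (k := ⊤) le_top hK hqinj hqimm
  have hle : ((k : ℕ∞) : WithTop ℕ∞) ≤ ∞ := mod_cast le_top
  have hh : ContDiff ℝ k fun b => r b - p (r b) := (hr.sub (hp.comp hr)).of_le hle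
  refine ⟨(((T.diffeomorphOfClass k).trans (shearFst _ hh)).trans
    (shearSnd q (hq.of_le hle))).trans (S.diffeomorphOfClass k), fun x hx => ?_⟩
  rw [← hS]
  show S ((p x + (r (q x) - p (r (q x)))), q x - q (p x + (r (q x) - p (r (q x))))) = S (x, 0)
  rw [hrq x hx]
  simp

/-- An injective immersion of a compact subset of `E` in `V` is the restriction of an ambient
diffeomorphism after a prescribed linear embedding when `3 * dim E < dim V`. -/
theorem ContDiffOn.exists_diffeomorph_eq_comp_linear {k : ℕ∞} (hk : 1 ≤ k) {K U : Set E}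
    (hK : IsCompact K) (hU : IsOpen U) (hKU : K ⊆ U) {f : E → V} (hf : ContDiffOn ℝ k f U)
    (hinj : InjOn f K) (himm : ∀ x ∈ K, Function.Injective (fderiv ℝ f x))
    (hdim : 3 * finrank ℝ E + 1 ≤ finrank ℝ V) (ι : E →ₗ[ℝ] V) (hι : Function.Injective ι) :
    ∃ Φ : Diffeomorph 𝓘(ℝ, V) 𝓘(ℝ, V) V V k, ∀ x ∈ K, f x = Φ (ι x) := by
  obtain ⟨f₁, hf₁, hc, heq⟩ := exists_contDiff_hasCompactSupport_eventuallyEq hK hU hKU hf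
  have hval : EqOn f₁ f K := fun x hx => (heq x hx).self_of_nhds
  obtain ⟨Φ, g, hg, hΦ, himmg⟩ := hf₁.exists_diffeomorph_comp_smooth hk hc hK
    (hinj.congr hval.symm) fun x hx => by rw [(heq x hx).fderiv_eq]; exact himm x hx
  have hinjg : InjOn g K := fun x hx y hy hxy => hinj hx hy <| by
    rw [← hval hx, ← hval hy]
    exact Φ.injective ((hΦ x hx).trans (hxy.trans (hΦ y hy).symm))
  obtain ⟨Ψ, hΨ⟩ := hg.exists_diffeomorph_straighten_of_smooth k hK hinjg himmg hdim ι hι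
  refine ⟨(Φ.trans Ψ).symm, fun x hx => ?_⟩
  rw [← hΨ x hx, ← hΦ x hx, hval hx]
  exact ((Φ.trans Ψ).symm_apply_apply (f x)).symm

end Straighten

/-! ### Zero padding and the theorem. -/

section Main

/-- Zero padding as a linear map. -/
def zeroPadLinear (n m : ℕ) : Euc n →ₗ[ℝ] Euc m where
  toFun := zeroPad n m
  map_add' x y := by
    ext i
    by_cases h : (i : ℕ) < n <;> simp [zeroPad, h]
  map_smul' c x := by
    ext i
    by_cases h : (i : ℕ) < n <;> simp [zeroPad, h]

theorem zeroPadLinear_injective {n m : ℕ} (h : n ≤ m) :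
    Function.Injective (zeroPadLinear n m) := fun x y hxy => by
  ext i
  have := congrArg (fun z : Euc m => z (Fin.castLE h i)) hxy
  simpa [zeroPadLinear, zeroPad] using this

theorem mem_fullRank_iff {n m : ℕ} {l : Euc n → Euc m} :
    l ∈ FullRank n m ↔ ∃ L : Euc n →ₗ[ℝ] Euc m, Function.Injective L ∧ l = L := by
  have key : ∀ M : Matrix (Fin m) (Fin n) ℝ,
      M.rank = n ↔ Function.Injective (Matrix.toEuclideanLin M) := fun M => by
    rw [Matrix.rank_eq_finrank_range_toLin M (EuclideanSpace.basisFun (Fin m) ℝ).toBasis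
      (EuclideanSpace.basisFun (Fin n) ℝ).toBasis, ← Matrix.toEuclideanLin_eq_toLin_orthonormal]
    have h := LinearMap.finrank_range_add_finrank_ker (Matrix.toEuclideanLin M)
    rw [finrank_euclideanSpace_fin] at h
    rw [← LinearMap.ker_eq_bot, ← Submodule.finrank_eq_zero (R := ℝ)]
    omega
  constructor
  · rintro ⟨M, hM, rfl⟩
    exact ⟨Matrix.toEuclideanLin M, (key M).1 hM, rfl⟩
  · rintro ⟨L, hL, rfl⟩
    refine ⟨Matrix.toEuclideanLin.symm L, (key _).2 ?_, ?_⟩ <;> simp [hL]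

theorem zeroPad_mem_fullRank {n m : ℕ} (h : n ≤ m) : zeroPad n m ∈ FullRank n m :=
  mem_fullRank_iff.2 ⟨zeroPadLinear n m, zeroPadLinear_injective h, rfl⟩

theorem extEmbOn_subset_embCOn {k : ℕ∞} (hk : 1 ≤ k) {n m : ℕ} {K : Set (Euc n)}
    (hK : IsCompact K) : ExtEmbOn k m K ⊆ EmbCOn k m K := by
  rintro _ ⟨_, ⟨_, ⟨Φ, rfl⟩, l, hl, rfl⟩, rfl⟩
  obtain ⟨L, hL, rfl⟩ := mem_fullRank_iff.1 hl
  have hk0 : (k : WithTop ℕ∞) ≠ 0 := by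
    have : k ≠ 0 := (zero_lt_one.trans_le hk).ne'
    exact_mod_cast this
  have hLc : ContDiff ℝ k L := (LinearMap.toContinuousLinearMap L).contDiff
  have hE : ContDiff ℝ k (Φ ∘ L) := Φ.contDiff.comp hLc
  have : CompactSpace K := isCompact_iff_compactSpace.1 hK
  refine ⟨Topology.IsClosedEmbedding.isEmbedding (Continuous.isClosedEmbedding
      (hE.continuous.comp continuous_subtype_val)
      ((Φ.injective.comp hL).comp Subtype.val_injective)),
    univ, Φ ∘ L, isOpen_univ, subset_univ _, hE.contDiffOn, fun _ => rfl, fun x _ => ?_⟩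
  have hcomp : HasFDerivAt (Φ.symm ∘ (Φ ∘ L))
      ((fderiv ℝ Φ.symm (Φ (L x))).comp (fderiv ℝ (Φ ∘ L) x)) x :=
    ((Φ.symm.contDiff.differentiable hk0) _).hasFDerivAt.comp x
      ((hE.differentiable hk0) x).hasFDerivAt
  -- Differentiating this identity shows that the differential of `Φ ∘ L` has injective composite,
  -- hence is injective.
  have hid : Φ.symm ∘ (Φ ∘ L) = LinearMap.toContinuousLinearMap L := by
    ext1 y; simp
  rw [hid] at hcomp
  have hu := hcomp.unique (LinearMap.toContinuousLinearMap L).hasFDerivAt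
  intro v w hvw
  refine hL ?_
  have hv := DFunLike.congr_fun hu v
  have hw := DFunLike.congr_fun hu w
  simp only [ContinuousLinearMap.comp_apply] at hv hw
  exact hv.symm.trans ((congrArg _ hvw).trans hw)

theorem mainTheorem2 (n m : ℕ) (hm : 3 * n + 1 ≤ m) (k : ℕ∞) (hk : 1 ≤ k)
    (K : Set (Euc n)) (hK : IsCompact K) :
    (∀ f ∈ EmbC k n m, ∃ E ∈ ExtEmb k n m, E '' K = f '' K) ∧
    (∀ f ∈ EmbC k n m, ∃ Φ ∈ DiffC k m, ∀ x ∈ K, f x = Φ (zeroPad n m x)) ∧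
    ExtEmbOn k m K = EmbCOn k m K := by
  have hnm : n ≤ m := by omega
  have key : ∀ (U : Set (Euc n)) (f : Euc n → Euc m), IsOpen U → K ⊆ U → ContDiffOn ℝ k f U →
      InjOn f K → (∀ x ∈ K, Function.Injective (fderiv ℝ f x)) →
      ∃ Φ ∈ DiffC k m, ∀ x ∈ K, f x = Φ (zeroPad n m x) := fun U f hU hKU hf hinj himm => by
    obtain ⟨Φ, hΦ⟩ := hf.exists_diffeomorph_eq_comp_linear hk hK hU hKU hinj himm
      (by simpa using hm) (zeroPadLinear n m) (zeroPadLinear_injective hnm)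
    exact ⟨Φ, ⟨Φ, rfl⟩, hΦ⟩
  have hb : ∀ f ∈ EmbC k n m, ∃ Φ ∈ DiffC k m, ∀ x ∈ K, f x = Φ (zeroPad n m x) :=
    fun f hf => key univ f isOpen_univ (subset_univ _) hf.2.1.contDiffOn hf.1.injective.injOn
      fun x _ => hf.2.2 x
  refine ⟨fun f hf => ?_, hb, (extEmbOn_subset_embCOn hk hK).antisymm ?_⟩
  · obtain ⟨Φ, hΦ, hfΦ⟩ := hb f hf
    exact ⟨Φ ∘ zeroPad n m, ⟨Φ, hΦ, _, zeroPad_mem_fullRank hnm, rfl⟩,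
      image_congr fun x hx => (hfΦ x hx).symm⟩
  · rintro f ⟨hf, U, g, hU, hKU, hg, hgf, himm⟩
    have hinj : InjOn g K := fun x hx y hy hxy => by
      have h : f ⟨x, hx⟩ = f ⟨y, hy⟩ := by rw [← hgf ⟨x, hx⟩, ← hgf ⟨y, hy⟩]; exact hxy
      exact congrArg Subtype.val (hf.injective h)
    obtain ⟨Φ, hΦ, hgΦ⟩ := key U g hU hKU hg hinj himm
    refine ⟨Φ ∘ zeroPad n m, ⟨Φ, hΦ, _, zeroPad_mem_fullRank hnm, rfl⟩, ?_⟩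
    funext x
    exact ((hgΦ x x.2).symm).trans (hgf x)

end Main
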